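/- Let $G=\bigoplus_{i=1}^{\infty}\mathbb{Z}$ be the discrete group of integer sequences with only finitely many non-zero terms, and let $\ell^1(G)$ be the Banach algebra of absolutely summable functions $f\colon G\to\mathbb{C}$ with convolution as product. Equip the bidual $\ell^1(G)''$ with the first Arens product $\Box$; that is, for a Banach algebra $A$, $$\langle \Psi\Box\Phi,\lambda\rangle=\langle\Psi,\Phi\cdot\lambda\rangle,\qquad \langle\Phi\cdot\lambda,a\rangle=\langle\Phi,\lambda\cdot a\rangle,\qquad \langle\lambda\cdot a,b\rangle=\langle\lambda,ab\rangle$$ for $\Phi,\Psi\in A''$, $\lambda\in A'$ and $a,b\in A$. Then the Jacobson radical of $(\ell^1(G)'',\Box)$ contains nilpotent elements of every index: for every integer $n\ge 1$ there is $\Phi\in\operatorname{rad}(\ell^1(G)'')$ such that $\Phi^{\Box n}=0$ but $\Phi^{\Box(n-1)}\neq 0$ (where $\Phi^{\Box 0}$ denotes the identity of $\ell^1(G)''$). -/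

import Mathlib

open scoped DirectSum

noncomputable section

/-! ### The first Arens product on the bidual of a normed algebra -/

section Arens

variable (𝕜 A : Type*) [NontriviallyNormedField 𝕜] [NormedRing A] [NormedAlgebra 𝕜 A]

/-- The bidual `A''` of a normed algebra `A`: the continuous dual of the continuous dual.
It carries the bidual norm and, below, the first Arens product as multiplication. -/
def ArensBidual : Type _ := StrongDual 𝕜 (StrongDual 𝕜 A)

namespace ArensBidual

instance : NormedAddCommGroup (ArensBidual 𝕜 A) :=
  inferInstanceAs (NormedAddCommGroup (StrongDual 𝕜 (StrongDual 𝕜 A)))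

instance : NormedSpace 𝕜 (ArensBidual 𝕜 A) :=
  inferInstanceAs (NormedSpace 𝕜 (StrongDual 𝕜 (StrongDual 𝕜 A)))

instance : FunLike (ArensBidual 𝕜 A) (StrongDual 𝕜 A) 𝕜 :=
  inferInstanceAs (FunLike (StrongDual 𝕜 (StrongDual 𝕜 A)) (StrongDual 𝕜 A) 𝕜)

instance : ContinuousLinearMapClass (ArensBidual 𝕜 A) 𝕜 (StrongDual 𝕜 A) 𝕜 :=
  inferInstanceAs
    (ContinuousLinearMapClass (StrongDual 𝕜 (StrongDual 𝕜 A)) 𝕜 (StrongDual 𝕜 A) 𝕜)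

variable {𝕜 A}

theorem le_norm (Φ : ArensBidual 𝕜 A) (l : StrongDual 𝕜 A) : ‖Φ l‖ ≤ ‖Φ‖ * ‖l‖ :=
  ContinuousLinearMap.le_opNorm (𝕜 := 𝕜) (E := StrongDual 𝕜 A) (F := 𝕜) Φ l

@[ext]
theorem ext {Φ Ψ : ArensBidual 𝕜 A} (h : ∀ l, Φ l = Ψ l) : Φ = Ψ :=
  DFunLike.ext _ _ h

@[simp]
theorem add_apply (Φ Ψ : ArensBidual 𝕜 A) (l : StrongDual 𝕜 A) : (Φ + Ψ) l = Φ l + Ψ l := rfl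

@[simp]
theorem zero_apply (l : StrongDual 𝕜 A) : (0 : ArensBidual 𝕜 A) l = 0 := rfl

@[simp]
theorem smul_apply (c : 𝕜) (Φ : ArensBidual 𝕜 A) (l : StrongDual 𝕜 A) :
    (c • Φ) l = c * Φ l := rfl

/-- `λ · a ∈ A'`, given by `⟨λ · a, b⟩ = ⟨λ, a b⟩`. -/
def dualMul (l : StrongDual 𝕜 A) (a : A) : StrongDual 𝕜 A :=
  l.comp (ContinuousLinearMap.mul 𝕜 A a)

@[simp]
theorem dualMul_apply (l : StrongDual 𝕜 A) (a b : A) : dualMul l a b = l (a * b) := rfl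

theorem norm_dualMul_le (l : StrongDual 𝕜 A) (a : A) : ‖dualMul l a‖ ≤ ‖l‖ * ‖a‖ :=
  ContinuousLinearMap.opNorm_le_bound _ (by positivity) fun b => by
    rw [dualMul_apply, mul_assoc]
    exact (l.le_opNorm _).trans (by gcongr; exact norm_mul_le _ _)

/-- `Φ · λ ∈ A'`, given by `⟨Φ · λ, a⟩ = ⟨Φ, λ · a⟩`. -/
def bidualMul (Φ : ArensBidual 𝕜 A) (l : StrongDual 𝕜 A) : StrongDual 𝕜 A :=
  LinearMap.mkContinuous
    { toFun := fun a => Φ (dualMul l a)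
      map_add' := fun a b => by
        rw [← map_add]; congr 1; ext c; simp [add_mul]
      map_smul' := fun r a => by
        rw [RingHom.id_apply, ← map_smul]; congr 1; ext c; simp }
    (‖Φ‖ * ‖l‖) fun a => by
      rw [mul_assoc]
      exact (le_norm Φ _).trans (by gcongr; exact norm_dualMul_le l a)

@[simp]
theorem bidualMul_apply (Φ : ArensBidual 𝕜 A) (l : StrongDual 𝕜 A) (a : A) :
    bidualMul Φ l a = Φ (dualMul l a) := rfl

theorem norm_bidualMul_le (Φ : ArensBidual 𝕜 A) (l : StrongDual 𝕜 A) :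
    ‖bidualMul Φ l‖ ≤ ‖Φ‖ * ‖l‖ :=
  LinearMap.mkContinuous_norm_le _ (by positivity) _

/-- The first Arens product `Ψ □ Φ`, given by `⟨Ψ □ Φ, λ⟩ = ⟨Ψ, Φ · λ⟩`. -/
def arensMul (Ψ Φ : ArensBidual 𝕜 A) : ArensBidual 𝕜 A :=
  LinearMap.mkContinuous (E := StrongDual 𝕜 A) (F := 𝕜)
    { toFun := fun l => Ψ (bidualMul Φ l)
      map_add' := fun l m => by
        rw [← map_add]; congr 1; ext a
        simp only [bidualMul_apply, _root_.add_apply]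
        rw [← map_add]; rfl
      map_smul' := fun r l => by
        rw [RingHom.id_apply, ← map_smul]; congr 1; ext a
        simp only [bidualMul_apply, _root_.smul_apply]
        rw [← map_smul]; rfl }
    (‖Ψ‖ * ‖Φ‖) fun l => by
      rw [mul_assoc]
      exact (le_norm Ψ _).trans (by gcongr; exact norm_bidualMul_le Φ l)

instance : Mul (ArensBidual 𝕜 A) := ⟨arensMul⟩

theorem mul_apply (Ψ Φ : ArensBidual 𝕜 A) (l : StrongDual 𝕜 A) :
    (Ψ * Φ) l = Ψ (bidualMul Φ l) := rfl

/-- The identity of `A''` is the image of `1 ∈ A` under the canonical embedding. -/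
instance : One (ArensBidual 𝕜 A) := ⟨NormedSpace.inclusionInDoubleDual 𝕜 A 1⟩

theorem one_apply (l : StrongDual 𝕜 A) : (1 : ArensBidual 𝕜 A) l = l 1 := rfl

theorem arensMul_norm_le (Ψ Φ : ArensBidual 𝕜 A) : ‖Ψ * Φ‖ ≤ ‖Ψ‖ * ‖Φ‖ :=
  ContinuousLinearMap.opNorm_le_bound (𝕜 := 𝕜) (E := StrongDual 𝕜 A) (F := 𝕜) _
    (by positivity) fun l => by
      rw [mul_assoc]
      exact (le_norm Ψ _).trans (by gcongr; exact norm_bidualMul_le Φ l)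

instance : NormedRing (ArensBidual 𝕜 A) where
  __ := (inferInstance : NormedAddCommGroup (ArensBidual 𝕜 A))
  mul := (· * ·)
  one := 1
  left_distrib Φ Ψ Θ := by
    ext l
    rw [add_apply, mul_apply, mul_apply, mul_apply, ← map_add]
    congr 1
  right_distrib Φ Ψ Θ := by ext l; rfl
  zero_mul Φ := by ext l; rfl
  mul_zero Φ := by
    ext l
    rw [mul_apply]
    exact map_zero Φ
  mul_assoc Φ Ψ Θ := by
    ext l
    simp only [mul_apply]
    congr 1
    ext a
    simp only [bidualMul_apply, mul_apply]
    congr 1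
    ext b
    simp only [bidualMul_apply, dualMul_apply]
    congr 1
    ext c
    simp [mul_assoc]
  one_mul Φ := by
    ext l
    rw [mul_apply, one_apply, bidualMul_apply]
    congr 1
    ext a
    simp
  mul_one Φ := by
    ext l
    rw [mul_apply]
    congr 1
    ext a
    rw [bidualMul_apply, one_apply, dualMul_apply, mul_one]
  norm_mul_le := arensMul_norm_le

end ArensBidual

end Arens

/-! ### The group algebra `ℓ¹(G)` of a discrete group, written additively -/

section GroupAlgebra

/-- `ℓ¹(G)`: the functions `f : G → ℂ` with `∑ |f s| < ∞`, normed by `‖f‖ = ∑ |f s|`.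
Its multiplication, defined below, is convolution. -/
def EllOne (G : Type*) : Type _ := lp (fun _ : G => ℂ) 1

namespace EllOne

variable {G : Type*}

instance : NormedAddCommGroup (EllOne G) :=
  inferInstanceAs (NormedAddCommGroup (lp (fun _ : G => ℂ) 1))

instance : NormedSpace ℂ (EllOne G) := inferInstanceAs (NormedSpace ℂ (lp (fun _ : G => ℂ) 1))

instance : CompleteSpace (EllOne G) := inferInstanceAs (CompleteSpace (lp (fun _ : G => ℂ) 1))

instance : FunLike (EllOne G) G ℂ where
  coe f := Subtype.val (p := fun x => x ∈ lp (fun _ : G => ℂ) 1) f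
  coe_injective := Subtype.val_injective

theorem ext {f g : EllOne G} (h : ∀ s, f s = g s) : f = g := DFunLike.ext _ _ h

theorem add_apply (f g : EllOne G) (s : G) : (f + g) s = f s + g s := rfl

theorem smul_apply (c : ℂ) (f : EllOne G) (s : G) : (c • f) s = c * f s := rfl

theorem zero_apply (s : G) : (0 : EllOne G) s = 0 := rfl

theorem summable_norm (f : EllOne G) : Summable fun s => ‖f s‖ := by
  have h := (memℓp_gen_iff (p := 1) (by simp)).1
    (lp.memℓp (show lp (fun _ : G => ℂ) 1 from f))
  simp only [ENNReal.toReal_one, Real.rpow_one] at h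
  exact h

theorem norm_eq (f : EllOne G) : ‖f‖ = ∑' s, ‖f s‖ := by
  have h := lp.norm_eq_tsum_rpow (p := 1) (by simp) (show lp (fun _ : G => ℂ) 1 from f)
  simp only [ENNReal.toReal_one, Real.rpow_one, div_one] at h
  exact h

/-- An absolutely summable function, as an element of `ℓ¹(G)`. -/
def mk (f : G → ℂ) (hf : Summable fun s => ‖f s‖) : EllOne G :=
  ⟨f, (memℓp_gen_iff (p := 1) (by simp)).2 (by simpa using hf)⟩

@[simp]
theorem mk_apply (f : G → ℂ) (hf : Summable fun s => ‖f s‖) (s : G) : mk f hf s = f s := rfl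

variable [AddGroup G]

/-- The bijection `(t, s) ↦ (t, -t + s)` of `G × G`. -/
def shear : G × G ≃ G × G where
  toFun p := (p.1, -p.1 + p.2)
  invFun p := (p.1, p.1 + p.2)
  left_inv p := by simp
  right_inv p := by simp

theorem summable_shear (f g : EllOne G) :
    Summable fun p : G × G => ‖f p.1 * g (-p.1 + p.2)‖ := by
  have h : Summable fun p : G × G => ‖f p.1‖ * ‖g p.2‖ :=
    f.summable_norm.mul_of_nonneg g.summable_norm (fun _ => norm_nonneg _) fun _ => norm_nonneg _
  simpa [Function.comp_def, shear] using (shear (G := G)).summable_iff.2 h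

theorem summable_conv_term (f g : EllOne G) (s : G) :
    Summable fun t => ‖f t * g (-t + s)‖ :=
  (summable_shear f g).prod_symm.prod_factor s

theorem summable_conv (f g : EllOne G) :
    Summable fun s => ‖∑' t, f t * g (-t + s)‖ :=
  Summable.of_nonneg_of_le (fun _ => norm_nonneg _)
    (fun s => norm_tsum_le_tsum_norm (summable_conv_term f g s))
    (summable_shear f g).prod_symm.prod

/-- Convolution: `(f * g)(s) = ∑ₜ f(t) g(t⁻¹ s)`, in additive notation. -/
instance : Mul (EllOne G) := ⟨fun f g => mk (fun s => ∑' t, f t * g (-t + s)) (summable_conv f g)⟩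

theorem mul_apply (f g : EllOne G) (s : G) : (f * g) s = ∑' t, f t * g (-t + s) := rfl

open Classical in
/-- The identity is the point mass at the neutral element. -/
instance : One (EllOne G) :=
  ⟨mk (fun s => if s = 0 then 1 else 0)
    (summable_of_hasFiniteSupport ((Set.finite_singleton (0 : G)).subset fun s hs => by
      by_contra h
      simp_all))⟩

open Classical in
theorem one_apply (s : G) : (1 : EllOne G) s = if s = 0 then 1 else 0 := rfl

theorem conv_norm_le (f g : EllOne G) : ‖f * g‖ ≤ ‖f‖ * ‖g‖ := by
  have h1 := (summable_shear f g).prod_symm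
  have h2 : Summable fun p : G × G => ‖f p.1‖ * ‖g p.2‖ :=
    f.summable_norm.mul_of_nonneg g.summable_norm (fun _ => norm_nonneg _) fun _ => norm_nonneg _
  calc ‖f * g‖ = ∑' s, ‖∑' t, f t * g (-t + s)‖ := norm_eq _
    _ ≤ ∑' s, ∑' t, ‖f t * g (-t + s)‖ :=
      (summable_conv f g).tsum_le_tsum
        (fun s => norm_tsum_le_tsum_norm (summable_conv_term f g s)) h1.prod
    _ = ∑' p : G × G, ‖f p.1 * g (-p.1 + p.2)‖ := by
      refine h1.tsum_prod.symm.trans ?_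
      exact (Equiv.prodComm G G).tsum_eq fun p : G × G => ‖f p.1 * g (-p.1 + p.2)‖
    _ = ∑' p : G × G, ‖f p.1‖ * ‖g p.2‖ := by
      rw [← (shear (G := G)).tsum_eq fun p : G × G => ‖f p.1‖ * ‖g p.2‖]
      simp [shear]
    _ = ‖f‖ * ‖g‖ := by
      rw [norm_eq, norm_eq, f.summable_norm.tsum_mul_tsum g.summable_norm h2]

theorem conv_assoc (f g h : EllOne G) : f * g * h = f * (g * h) := by
  apply ext
  intro s
  -- summability of `f u * g (-u + t) * h (-t + s)` over `(u, t)`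
  obtain ⟨C, hC⟩ : ∃ C, ∀ t, ‖h t‖ ≤ C :=
    ⟨‖h‖, fun t => by rw [norm_eq]; exact h.summable_norm.le_tsum t fun _ _ => norm_nonneg _⟩
  have hs : Summable fun p : G × G => f p.1 * g (-p.1 + p.2) * h (-p.2 + s) := by
    refine Summable.of_norm_bounded ((summable_shear f g).mul_right C) fun p => ?_
    rw [norm_mul]
    gcongr
    exact hC _
  simp only [mul_apply]
  calc ∑' t, (∑' u, f u * g (-u + t)) * h (-t + s)
      = ∑' t, ∑' u, f u * g (-u + t) * h (-t + s) := by simp only [tsum_mul_right]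
    _ = ∑' u, ∑' t, f u * g (-u + t) * h (-t + s) := hs.tsum_comm
    _ = ∑' u, f u * ∑' t, g t * h (-t + (-u + s)) := by
      congr 1
      ext u
      rw [← tsum_mul_left, ← (Equiv.addLeft u).tsum_eq]
      congr 1
      ext t
      simp only [Equiv.coe_addLeft, neg_add_cancel_left, neg_add_rev, mul_assoc, add_assoc]

instance : NormedRing (EllOne G) where
  __ := (inferInstance : NormedAddCommGroup (EllOne G))
  mul := (· * ·)
  one := 1
  left_distrib f g h := by
    apply ext
    intro s
    simp only [mul_apply, add_apply, mul_add]
    exact (summable_conv_term f g s).of_norm.tsum_add (summable_conv_term f h s).of_norm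
  right_distrib f g h := by
    apply ext
    intro s
    simp only [mul_apply, add_apply, add_mul]
    exact (summable_conv_term f h s).of_norm.tsum_add (summable_conv_term g h s).of_norm
  zero_mul f := by
    apply ext
    intro s
    simp [mul_apply, zero_apply]
  mul_zero f := by
    apply ext
    intro s
    simp [mul_apply, zero_apply]
  mul_assoc := conv_assoc
  one_mul f := by
    apply ext
    intro s
    rw [mul_apply, tsum_eq_single 0]
    · simp [one_apply]
    · intro t ht
      simp [one_apply, ht]
  mul_one f := by
    apply ext
    intro s
    rw [mul_apply, tsum_eq_single s]
    · simp [one_apply]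
    · intro t ht
      have : -t + s ≠ 0 := fun h => ht (neg_add_eq_zero.1 h)
      simp [one_apply, this]
  norm_mul_le := conv_norm_le

instance : NormedAlgebra ℂ (EllOne G) where
  __ := Algebra.ofModule
    (fun c f g => by
      apply ext
      intro s
      simp only [mul_apply, smul_apply, mul_assoc, tsum_mul_left])
    (fun c f g => by
      apply ext
      intro s
      simp only [mul_apply, smul_apply, mul_left_comm _ c, tsum_mul_left])
  norm_smul_le := norm_smul_le

end EllOne

end GroupAlgebra

end

open Filter Topology

/-! ### Nilpotent elements built from a one-sided triangular family -/

/-! Let `P j` and `N j` be weak-* limits of the averages of the point masses at `i • e_j` and at `-i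
• e_j`, for `i = 0, …, k - 1`. Both are invariant under translation by `e_j`, and either one fixes
by left multiplication any `X` invariant under that translation, so `(P j - N j) * X = 0`. Put `f i
= P 0 * ⋯ * P (i - 1) * (P i - N i)`, which is invariant along the axes `0, …, i`.

Point masses are central in the bidual, so `Ψ * f j` is invariant along the axis `i ≤ j`, and `f i *
Ψ * f j = 0` for every `Ψ` (`axisDiff_mul_mul_axisDiff`). The case `i = j` puts each `f i` in the
radical. With `Ψ = 1` the family is strictly triangular: only products with decreasing indices can
survive, so the sum of `f 0, …, f (m - 1)` has `(m + 1)`-st power `0` and `m`-th power `f (m - 1) *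
⋯ * f 0`.

That product is nonzero because it can be tested on the indicator of an orthant. Averaging towards
`+∞` along an axis removes the sign condition there, and averaging towards `-∞` gives `0`. Hence
each factor removes one condition (`bidualMul_axisDiff_orthantDual`), and the constant function `1`
is left. -/

theorem Ring.mem_jacobson_of_mul_mul_self {R : Type*} [Ring R] {x : R}
    (h : ∀ y, x * y * x = 0) : x ∈ Ring.jacobson R := by
  rw [← Ideal.jacobson_bot, Ideal.mem_jacobson_iff]
  intro y
  -- Since `y * x` squares to zero, `1 - y * x` is the inverse of `1 + y * x`.
  refine ⟨1 - y * x, ?_⟩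
  have h' : y * x * (y * x) = 0 := by rw [mul_assoc, ← mul_assoc x, h, mul_zero]
  rw [Ideal.mem_bot, mul_assoc, sub_mul, one_mul, h']
  abel

section Triangular

variable {R : Type*} [Ring R] {f : ℕ → R}

/-- In the expansion of the power, `f m` is killed by every factor standing to its left, itself
included. It can therefore occur only once, in front. -/
theorem sum_range_succ_pow_succ_of_mul_eq_zero (h : ∀ i j, i ≤ j → f i * f j = 0) (m k : ℕ) :
    (∑ i ∈ Finset.range (m + 1), f i) ^ (k + 1) =
      (∑ i ∈ Finset.range m, f i) ^ (k + 1) + f m * (∑ i ∈ Finset.range m, f i) ^ k := by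
  set S := ∑ i ∈ Finset.range m, f i with hS
  have hSf : S * f m = 0 := by
    rw [hS, Finset.sum_mul]
    exact Finset.sum_eq_zero fun i hi => h i m (Finset.mem_range.1 hi).le
  rw [Finset.sum_range_succ, ← hS]
  induction k with
  | zero => simp
  | succ k ih =>
    rw [pow_succ', ih, add_mul, mul_add, mul_add, ← mul_assoc S (f m), hSf,
      ← mul_assoc (f m) (f m), h m m le_rfl, ← pow_succ']
    simp

theorem sum_range_pow_succ_eq_zero (h : ∀ i j, i ≤ j → f i * f j = 0) (m : ℕ) :
    (∑ i ∈ Finset.range m, f i) ^ (m + 1) = 0 := by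
  induction m with
  | zero => simp
  | succ m ih =>
    rw [sum_range_succ_pow_succ_of_mul_eq_zero h, ih, pow_succ, ih, mul_zero, zero_mul, add_zero]

theorem sum_range_succ_pow_self (h : ∀ i j, i ≤ j → f i * f j = 0) (m : ℕ) :
    (∑ i ∈ Finset.range (m + 1), f i) ^ (m + 1) = f m * (∑ i ∈ Finset.range m, f i) ^ m := by
  rw [sum_range_succ_pow_succ_of_mul_eq_zero h, sum_range_pow_succ_eq_zero h, zero_add]

end Triangular

/-! ### Cesàro limits in the bidual -/

namespace ArensBidual

variable {A : Type*} [NormedRing A] [NormedAlgebra ℂ A]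

/-- The canonical image of `a : A` in the bidual. -/
noncomputable def incl (a : A) : ArensBidual ℂ A := NormedSpace.inclusionInDoubleDual ℂ A a

@[simp]
theorem incl_apply (a : A) (l : StrongDual ℂ A) : incl a l = l a := rfl

theorem incl_mul_apply (a : A) (Φ : ArensBidual ℂ A) (l : StrongDual ℂ A) :
    (incl a * Φ) l = Φ (dualMul l a) := rfl

theorem incl_mul (a b : A) : incl (a * b) = incl a * incl b := rfl

theorem incl_one : incl (1 : A) = 1 := rfl

/-- The Arens product need not be commutative even when `A` is, but central elements of `A` remain
central in the bidual. -/
theorem commute_incl {a : A} (ha : ∀ b, Commute a b) (Φ : ArensBidual ℂ A) :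
    Commute (incl a) Φ := by
  ext l
  rw [incl_mul_apply, mul_apply]
  congr 1
  ext b
  simp [(ha b).eq]

/-- In a product the rightmost factor acts first on functionals. -/
theorem bidualMul_mul (Ψ Φ : ArensBidual ℂ A) (l : StrongDual ℂ A) :
    bidualMul (Ψ * Φ) l = bidualMul Ψ (bidualMul Φ l) := by
  ext a
  simp only [bidualMul_apply, mul_apply]
  congr 1
  ext b
  simp only [bidualMul_apply, dualMul_apply]
  congr 1
  ext c
  simp [mul_assoc]

theorem bidualMul_sub (Ψ Φ : ArensBidual ℂ A) (l : StrongDual ℂ A) :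
    bidualMul (Ψ - Φ) l = bidualMul Ψ l - bidualMul Φ l := rfl

theorem bidualMul_one (l : StrongDual ℂ A) : bidualMul (1 : ArensBidual ℂ A) l = l := by
  ext a
  simp [one_apply]

/-- `P` is a limit, along a fixed ultrafilter, of the averages of the powers of `x`. -/
def IsCesaroLimit (x : A) (P : ArensBidual ℂ A) : Prop :=
  ∀ l : StrongDual ℂ A,
    Tendsto (fun k : ℕ => (k : ℂ)⁻¹ * ∑ i ∈ Finset.range k, l (x ^ i)) (hyperfilter ℕ) (𝓝 (P l))

/-- The averages lie in the unit ball of the bidual, which is weak-* compact by Banach–Alaoglu, so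
they converge along the ultrafilter. -/
theorem exists_isCesaroLimit {x : A} (hx : ∀ i : ℕ, ‖x ^ i‖ ≤ 1) : ∃ P, IsCesaroLimit x P := by
  let u : ℕ → StrongDual ℂ (StrongDual ℂ A) := fun k =>
    NormedSpace.inclusionInDoubleDual ℂ A ((k : ℂ)⁻¹ • ∑ i ∈ Finset.range k, x ^ i)
  have hu : ∀ k, ‖u k‖ ≤ 1 := fun k => by
    refine (NormedSpace.double_dual_bound ℂ A _).trans ?_
    rw [norm_smul, norm_inv, Complex.norm_natCast]
    have h : ‖∑ i ∈ Finset.range k, x ^ i‖ ≤ k := by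
      simpa using norm_sum_le_of_le (Finset.range k) (f := fun i => x ^ i) fun i _ => hx i
    exact (mul_le_mul_of_nonneg_left h (by positivity)).trans (inv_mul_le_one)
  let v : ℕ → WeakDual ℂ (StrongDual ℂ A) := fun k => StrongDual.toWeakDual (u k)
  obtain ⟨P, -, hP⟩ :=
    (WeakDual.isCompact_closedBall (0 : StrongDual ℂ (StrongDual ℂ A)) 1).ultrafilter_le_nhds
      ((hyperfilter ℕ).map v) (by
        rw [le_principal_iff, Ultrafilter.mem_coe, Ultrafilter.mem_map]
        exact Eventually.of_forall fun k => by simpa [v] using hu k)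
  refine ⟨WeakDual.toStrongDual P, fun l => ?_⟩
  have hP' : Tendsto v (hyperfilter ℕ) (𝓝 P) := hP
  have := ((WeakDual.eval_continuous l).tendsto P).comp hP'
  refine this.congr fun k => ?_
  change l ((k : ℂ)⁻¹ • ∑ i ∈ Finset.range k, x ^ i) = _
  simp

namespace IsCesaroLimit

variable {x : A} {P : ArensBidual ℂ A}

theorem hyperfilter_nat_le_atTop : (hyperfilter ℕ : Filter ℕ) ≤ atTop := by
  rw [← Nat.cofinite_eq_atTop]
  exact hyperfilter_le_cofinite

theorem apply_eq (hP : IsCesaroLimit x P) {l : StrongDual ℂ A} {c : ℂ}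
    (h : Tendsto (fun i : ℕ => l (x ^ i)) atTop (𝓝 c)) : P l = c := by
  refine tendsto_nhds_unique (hP l) ?_
  refine (h.cesaro_smul.mono_left hyperfilter_nat_le_atTop).congr fun k => ?_
  rw [Complex.real_smul]
  simp

/-- The first Arens product is weak-* continuous in its left factor, so `P * X` is the limit of
averages of `x ^ i * X`, all equal to `X`. -/
theorem mul_eq_self (hP : IsCesaroLimit x P) {X : ArensBidual ℂ A} (hX : incl x * X = X) :
    P * X = X := by
  ext l
  rw [mul_apply]
  refine hP.apply_eq ?_
  have hpow : ∀ i : ℕ, incl (x ^ i) * X = X := fun i => by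
    induction i with
    | zero => rw [pow_zero, incl_one, one_mul]
    | succ i ih => rw [pow_succ, incl_mul, mul_assoc, hX, ih]
  simp only [bidualMul_apply, ← incl_mul_apply, hpow]
  exact tendsto_const_nhds

theorem incl_mul_eq_self (hP : IsCesaroLimit x P) (hx : ∀ i : ℕ, ‖x ^ i‖ ≤ 1) :
    incl x * P = P := by
  ext l
  rw [incl_mul_apply]
  refine tendsto_nhds_unique (hP _) ?_
  -- Multiplication by `x` shifts the average, changing it by the telescoped difference `(x ^ k - 1)
  -- / k`, which tends to `0`.
  have hlim : Tendsto (fun k : ℕ => (k : ℂ)⁻¹ * (l (x ^ k) - l (x ^ 0))) (hyperfilter ℕ)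
      (𝓝 0) := by
    refine Tendsto.mono_left ?_ hyperfilter_nat_le_atTop
    refine squeeze_zero_norm (a := fun k : ℕ => (k : ℝ)⁻¹ * (‖l‖ + ‖l‖)) (fun k => ?_) ?_
    · rw [norm_mul, norm_inv, Complex.norm_natCast]
      gcongr
      refine (norm_sub_le _ _).trans (add_le_add ?_ ?_) <;>
        exact (l.le_opNorm _).trans (mul_le_of_le_one_right (norm_nonneg _) (hx _))
    · simpa using (tendsto_inv_atTop_nhds_zero_nat (𝕜 := ℝ)).mul_const (‖l‖ + ‖l‖)
  have := (hP l).add hlim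
  rw [add_zero] at this
  refine this.congr fun k => ?_
  rw [← Finset.sum_range_sub (fun i => l (x ^ i)), ← mul_add, ← Finset.sum_add_distrib]
  simp [pow_succ']

end IsCesaroLimit

end ArensBidual

/-! ### Point masses and bounded functions -/

namespace EllOne

section

variable {G : Type*}

open Classical in
/-- The point mass at `s`. -/
noncomputable def delta (s : G) : EllOne G := lp.single (E := fun _ : G => ℂ) 1 s (1 : ℂ)

open Classical in
theorem delta_apply (s t : G) : delta s t = if t = s then 1 else 0 := by
  change Pi.single (M := fun _ : G => ℂ) s (1 : ℂ) t = _
  rw [Pi.single_apply]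

theorem norm_delta (s : G) : ‖delta s‖ = 1 := by
  classical
  rw [norm_eq, tsum_eq_single s] <;> simp +contextual [delta_apply]

theorem dual_ext {l m : StrongDual ℂ (EllOne G)} (h : ∀ s, l (delta s) = m (delta s)) :
    l = m := by
  classical
  refine lp.ext_continuousLinearMap (𝕜 := ℂ) (E := fun _ : G => ℂ) (p := 1) (F := ℂ)
    (by simp) fun i => ?_
  ext
  exact h i

/-- The functional on `ℓ¹(G)` given by a function bounded by `1`. -/
noncomputable def ofBounded (f : G → ℂ) (hf : ∀ s, ‖f s‖ ≤ 1) : StrongDual ℂ (EllOne G) :=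
  have hle : ∀ (a : EllOne G) s, ‖f s * a s‖ ≤ ‖a s‖ := fun a s => by
    rw [norm_mul]
    exact mul_le_of_le_one_left (norm_nonneg _) (hf s)
  have hs : ∀ a : EllOne G, Summable fun s => ‖f s * a s‖ := fun a =>
    Summable.of_nonneg_of_le (fun _ => norm_nonneg _) (hle a) a.summable_norm
  LinearMap.mkContinuous
    { toFun := fun a => ∑' s, f s * a s
      map_add' := fun a b => by
        simp only [add_apply, mul_add]
        exact (hs a).of_norm.tsum_add (hs b).of_norm
      map_smul' := fun c a => by
        simp only [smul_apply, mul_left_comm _ c, tsum_mul_left, RingHom.id_apply, smul_eq_mul] }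
    1 fun a => by
      rw [one_mul, norm_eq]
      exact (norm_tsum_le_tsum_norm (hs a)).trans ((hs a).tsum_le_tsum (hle a) a.summable_norm)

theorem ofBounded_delta (f : G → ℂ) (hf : ∀ s, ‖f s‖ ≤ 1) (s : G) :
    ofBounded f hf (delta s) = f s := by
  classical
  change ∑' t, f t * delta s t = f s
  rw [tsum_eq_single s] <;> simp +contextual [delta_apply]

end

theorem delta_zero {G : Type*} [AddGroup G] : delta (0 : G) = 1 := by
  classical
  refine ext fun s => ?_
  rw [delta_apply, one_apply]

theorem delta_mul_apply {G : Type*} [AddGroup G] (s : G) (a : EllOne G) (t : G) :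
    (delta s * a) t = a (-s + t) := by
  classical
  rw [mul_apply, tsum_eq_single s] <;> simp +contextual [delta_apply]

theorem delta_mul_delta {G : Type*} [AddGroup G] (s t : G) :
    delta s * delta t = delta (s + t) := by
  classical
  refine ext fun r => ?_
  rw [delta_mul_apply, delta_apply, delta_apply]
  simp only [neg_add_eq_iff_eq_add]

theorem delta_pow {G : Type*} [AddGroup G] (s : G) (i : ℕ) : delta s ^ i = delta (i • s) := by
  induction i with
  | zero => rw [pow_zero, zero_nsmul, delta_zero]
  | succ i ih => rw [pow_succ, ih, delta_mul_delta, succ_nsmul]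

theorem commute_delta {G : Type*} [AddCommGroup G] (s : G) (a : EllOne G) :
    Commute (delta s) a := by
  classical
  refine ext fun t => ?_
  rw [delta_mul_apply, mul_apply, tsum_eq_single (-s + t)]
  · simp [delta_apply]
  · intro r hr
    have : -r + t ≠ s := fun h => hr (by rw [← h]; abel)
    simp [delta_apply, this]

end EllOne

/-! ### Invariant means on the coordinate axes -/

namespace ArensBidual

open EllOne

section Mean

variable {G : Type*} [AddCommGroup G]

theorem exists_mean (s : G) : ∃ P, IsCesaroLimit (delta s) P :=
  exists_isCesaroLimit fun i => by rw [delta_pow, norm_delta]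

/-- An invariant mean supported on the semigroup generated by `s`. -/
noncomputable def mean (s : G) : ArensBidual ℂ (EllOne G) := (exists_mean s).choose

theorem isCesaroLimit_mean (s : G) : IsCesaroLimit (delta s) (mean s) := (exists_mean s).choose_spec

theorem incl_delta_neg_mul_eq_self {s : G} {X : ArensBidual ℂ (EllOne G)}
    (hX : incl (delta s) * X = X) : incl (delta (-s)) * X = X := by
  conv_lhs => rw [← hX]
  rw [← mul_assoc, ← incl_mul, delta_mul_delta, neg_add_cancel, delta_zero, incl_one, one_mul]

theorem incl_delta_mul_mean (s : G) : incl (delta s) * mean s = mean s :=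
  (isCesaroLimit_mean s).incl_mul_eq_self fun i => by rw [delta_pow, norm_delta]

theorem incl_delta_mul_mean_neg (s : G) : incl (delta s) * mean (-s) = mean (-s) := by
  simpa using incl_delta_neg_mul_eq_self (incl_delta_mul_mean (-s))

theorem incl_delta_mul_comm (s : G) (X : ArensBidual ℂ (EllOne G)) :
    incl (delta s) * X = X * incl (delta s) :=
  (commute_incl (commute_delta s) X).eq

theorem mean_sub_mean_neg_mul {s : G} {X : ArensBidual ℂ (EllOne G)}
    (hX : incl (delta s) * X = X) : (mean s - mean (-s)) * X = 0 := by
  rw [sub_mul, (isCesaroLimit_mean s).mul_eq_self hX,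
    (isCesaroLimit_mean (-s)).mul_eq_self (incl_delta_neg_mul_eq_self hX), sub_self]

/-- The mean sees only the values of `f` far out along each ray `t + i • s`. -/
theorem bidualMul_mean_ofBounded {f g : G → ℂ} {hf : ∀ s, ‖f s‖ ≤ 1} {hg : ∀ s, ‖g s‖ ≤ 1} {s : G}
    (h : ∀ t, ∀ᶠ i : ℕ in atTop, f (t + i • s) = g t) :
    bidualMul (mean s) (ofBounded f hf) = ofBounded g hg := by
  refine dual_ext fun t => ?_
  rw [bidualMul_apply, ofBounded_delta]
  refine (isCesaroLimit_mean s).apply_eq (tendsto_const_nhds.congr' ?_)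
  filter_upwards [h t] with i hi
  rw [dualMul_apply, delta_pow, delta_mul_delta, ofBounded_delta, hi]

end Mean

/-- The generator of the `j`-th summand of `⨁ ℤ`. -/
def axis (j : ℕ) : ⨁ _ : ℕ, ℤ := DirectSum.of (fun _ => ℤ) j 1

theorem add_nsmul_axis_apply (t : ⨁ _ : ℕ, ℤ) (i j k : ℕ) :
    (t + i • axis j) k = t k + if k = j then (i : ℤ) else 0 := by
  rw [axis, ← map_nsmul, DirectSum.add_apply]
  congr 1
  rw [DirectSum.of_apply]
  split_ifs <;> simp_all

theorem add_nsmul_neg_axis_apply (t : ⨁ _ : ℕ, ℤ) (i j k : ℕ) :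
    (t + i • -axis j) k = t k - if k = j then (i : ℤ) else 0 := by
  rw [axis, ← map_neg, ← map_nsmul, DirectSum.add_apply, sub_eq_add_neg]
  congr 1
  rw [DirectSum.of_apply]
  split_ifs <;> simp_all

/-- The product of the positive means on the first `i` axes. -/
noncomputable def axisMeans : ℕ → ArensBidual ℂ (EllOne (⨁ _ : ℕ, ℤ))
  | 0 => 1
  | i + 1 => axisMeans i * mean (axis i)

/-- An element invariant along the axes `0, …, i` and of total mass `0` along the axis `i`. -/
noncomputable def axisDiff (i : ℕ) : ArensBidual ℂ (EllOne (⨁ _ : ℕ, ℤ)) :=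
  axisMeans i * (mean (axis i) - mean (-axis i))

theorem incl_delta_mul_axisMeans {i j : ℕ} (h : j < i) :
    incl (delta (axis j)) * axisMeans i = axisMeans i := by
  induction i with
  | zero => omega
  | succ i ih =>
    rw [axisMeans, ← mul_assoc]
    rcases Nat.lt_succ_iff_lt_or_eq.1 h with h | rfl
    · rw [ih h]
    · rw [incl_delta_mul_comm, mul_assoc, incl_delta_mul_mean]

theorem incl_delta_mul_axisDiff {i j : ℕ} (h : j ≤ i) :
    incl (delta (axis j)) * axisDiff i = axisDiff i := by
  rw [axisDiff, ← mul_assoc]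
  rcases h.lt_or_eq with h | rfl
  · rw [incl_delta_mul_axisMeans h]
  · rw [incl_delta_mul_comm, mul_assoc, mul_sub, incl_delta_mul_mean, incl_delta_mul_mean_neg]

/-- Translation along the axis `i` moves past `Ψ` and is absorbed by `axisDiff j`, so `Ψ * axisDiff
j` is annihilated by the difference of the two means. -/
theorem axisDiff_mul_mul_axisDiff {i j : ℕ} (h : i ≤ j)
    (Ψ : ArensBidual ℂ (EllOne (⨁ _ : ℕ, ℤ))) : axisDiff i * Ψ * axisDiff j = 0 := by
  rw [axisDiff, mul_assoc, mul_assoc, mean_sub_mean_neg_mul, mul_zero]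
  rw [← mul_assoc, incl_delta_mul_comm, mul_assoc, incl_delta_mul_axisDiff h]

open Classical in
/-- The indicator function of the sequences that are non-negative at the places in `[a, b)`. -/
noncomputable def orthant (a b : ℕ) (s : ⨁ _ : ℕ, ℤ) : ℂ := if ∀ j, a ≤ j → j < b → 0 ≤ s j then 1 else 0

theorem norm_orthant_le (a b : ℕ) (s : ⨁ _ : ℕ, ℤ) : ‖orthant a b s‖ ≤ 1 := by
  rw [orthant]
  split_ifs <;> simp

/-- The functional given by the indicator function of an orthant. -/
noncomputable def orthantDual (a b : ℕ) : StrongDual ℂ (EllOne (⨁ _ : ℕ, ℤ)) :=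
  ofBounded (orthant a b) (norm_orthant_le a b)

theorem bidualMul_mean_orthantDual_of_lt {i a b : ℕ} (h : i < a) :
    bidualMul (mean (axis i)) (orthantDual a b) = orthantDual a b := by
  refine bidualMul_mean_ofBounded fun t => Eventually.of_forall fun k => ?_
  simp only [orthant, add_nsmul_axis_apply]
  congr 1
  refine propext (forall₃_congr fun j hj _ => ?_)
  rw [if_neg (by omega), add_zero]

theorem bidualMul_mean_orthantDual (a b : ℕ) :
    bidualMul (mean (axis a)) (orthantDual a b) = orthantDual (a + 1) b := by
  refine bidualMul_mean_ofBounded fun t => ?_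
  filter_upwards [eventually_ge_atTop (t a).natAbs] with k hk
  simp only [orthant, add_nsmul_axis_apply]
  congr 1
  refine propext ⟨fun H j hj hb => ?_, fun H j hj hb => ?_⟩
  · simpa [show j ≠ a by omega] using H j (by omega) hb
  · rcases hj.eq_or_lt with rfl | hj
    · rw [if_pos rfl]
      omega
    · simpa [show j ≠ a by omega] using H j hj hb

theorem bidualMul_mean_neg_orthantDual {a b : ℕ} (h : a < b) :
    bidualMul (mean (-axis a)) (orthantDual a b) = 0 := by
  have h0 : (0 : StrongDual ℂ (EllOne (⨁ _ : ℕ, ℤ))) = ofBounded (fun _ => 0) (by simp) :=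
    dual_ext fun s => by rw [ofBounded_delta]; rfl
  rw [h0]
  refine bidualMul_mean_ofBounded fun t => ?_
  -- The inequality is strict so that `t a - k` is negative, not merely non-positive.
  filter_upwards [eventually_gt_atTop (t a).natAbs] with k hk
  simp only [orthant, add_nsmul_neg_axis_apply]
  refine if_neg fun H => ?_
  have := H a le_rfl h
  rw [if_pos rfl] at this
  omega

theorem bidualMul_axisMeans_orthantDual {i a b : ℕ} (h : i ≤ a) :
    bidualMul (axisMeans i) (orthantDual a b) = orthantDual a b := by
  induction i with
  | zero => exact bidualMul_one _
  | succ i ih =>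
    rw [axisMeans, bidualMul_mul, bidualMul_mean_orthantDual_of_lt h, ih (by omega)]

/-- The difference of means acts first and removes the condition at `a`. The remaining means run
along axes below `a`, on which the new orthant imposes no condition. -/
theorem bidualMul_axisDiff_orthantDual {a b : ℕ} (h : a < b) :
    bidualMul (axisDiff a) (orthantDual a b) = orthantDual (a + 1) b := by
  rw [axisDiff, bidualMul_mul, bidualMul_sub, bidualMul_mean_orthantDual,
    bidualMul_mean_neg_orthantDual h, sub_zero, bidualMul_axisMeans_orthantDual a.le_succ]

theorem axisDiff_mul_axisDiff (i j : ℕ) (h : i ≤ j) : axisDiff i * axisDiff j = 0 := by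
  simpa using axisDiff_mul_mul_axisDiff h 1

theorem bidualMul_sum_axisDiff_pow {m b : ℕ} (h : m ≤ b) :
    bidualMul ((∑ i ∈ Finset.range m, axisDiff i) ^ m) (orthantDual 0 b) = orthantDual m b := by
  induction m with
  | zero => exact bidualMul_one _
  | succ m ih =>
    rw [sum_range_succ_pow_self axisDiff_mul_axisDiff, bidualMul_mul, ih (by omega),
      bidualMul_axisDiff_orthantDual h]

theorem sum_axisDiff_pow_ne_zero (m : ℕ) : (∑ i ∈ Finset.range m, axisDiff i) ^ m ≠ 0 := by
  intro h
  -- For `b = m` no condition remains, so the resulting functional takes the value `1` at every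
  -- point mass.
  have h1 := bidualMul_sum_axisDiff_pow (le_refl m)
  rw [h] at h1
  have h2 := DFunLike.congr_fun h1 (delta 0)
  rw [bidualMul_apply, zero_apply, orthantDual, ofBounded_delta, orthant,
    if_pos fun j _ _ => by simp] at h2
  exact zero_ne_one h2

end ArensBidual

theorem theorem1p3 (n : ℕ) (hn : 1 ≤ n) :
    ∃ Φ : ArensBidual ℂ (EllOne (⨁ _ : ℕ, ℤ)),
      Φ ∈ Ring.jacobson (ArensBidual ℂ (EllOne (⨁ _ : ℕ, ℤ))) ∧ Φ ^ n = 0 ∧ Φ ^ (n - 1) ≠ 0 := by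
  -- The sum has `m = n - 1` terms. For `n = 1` it is empty, and `0 ^ 0 = 1` is nonzero.
  obtain ⟨m, rfl⟩ := Nat.exists_eq_add_of_le' hn
  refine ⟨∑ i ∈ Finset.range m, ArensBidual.axisDiff i, ?_, ?_, ?_⟩
  · exact Submodule.sum_mem _ fun i _ =>
      Ring.mem_jacobson_of_mul_mul_self (ArensBidual.axisDiff_mul_mul_axisDiff le_rfl)
  · exact sum_range_pow_succ_eq_zero ArensBidual.axisDiff_mul_axisDiff m
  · exact ArensBidual.sum_axisDiff_pow_ne_zero m
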